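/- Let $W$ be the principal real branch of the Lambert function, i.e. the inverse of the map $w\mapsto w\,e^{w}$ restricted to $[-1,\infty)$, so that $W(x)e^{W(x)}=x$. Let $x_0>0$ be any real number and define $x_n=W(x_{n-1})$ for $n\ge 1$. Then there is a unique real constant $C=C(x_0)$ such that, as $n\to\infty$, \begin{align*} x_n ={}& \frac1n+\frac12\frac{\ln n}{n^2}+\frac{C}{n^2} +\frac14\frac{(\ln n)^2}{n^3}+\Bigl(C-\frac14\Bigr)\frac{\ln n}{n^3}+\Bigl(C^2-\frac12C+\frac16\Bigr)\frac1{n^3}\\ &+\frac18\frac{(\ln n)^3}{n^4}+\Bigl(\frac34C-\frac5{16}\Bigr)\frac{(\ln n)^2}{n^4}+\Bigl(\frac32C^2-\frac54C+\frac38\Bigr)\frac{\ln n}{n^4}+\Bigl(C^3-\frac54C^2+\frac34C-\frac7{48}\Bigr)\frac1{n^4}\\ &+\frac1{16}\frac{(\ln n)^4}{n^5}+\Bigl(\frac12C-\frac{13}{48}\Bigr)\frac{(\ln n)^3}{n^5}+\Bigl(\frac32C^2-\frac{13}8C+\frac{17}{32}\Bigr)\frac{(\ln n)^2}{n^5}\\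 &+\Bigl(2C^3-\frac{13}4C^2+\frac{17}8C-\frac{23}{48}\Bigr)\frac{\ln n}{n^5}+\Bigl(C^4-\frac{13}6C^3+\frac{17}8C^2-\frac{23}{24}C+\frac{707}{4320}\Bigr)\frac1{n^5} +O\!\left(\frac{(\ln n)^5}{n^6}\right). \end{align*} -/

import Mathlib

/-- The principal real branch of the Lambert `W` function: the inverse of the function
`w ↦ w * exp w` restricted to the interval `[-1, ∞)`, where it is injective with image
`[-1/e, ∞)`. Only its values on that image are meaningful. -/
noncomputable def lambertW (x : ℝ) : ℝ :=
  Function.invFunOn (fun w : ℝ => w * Real.exp w) (Set.Ici (-1)) x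

theorem strictMonoOn_mul_exp :
    StrictMonoOn (fun w : ℝ => w * Real.exp w) (Set.Ici (-1)) := by
  refine strictMonoOn_of_deriv_pos (convex_Ici _) (by fun_prop) ?_
  intro w hw
  rw [interior_Ici, Set.mem_Ioi] at hw
  have h : HasDerivAt (fun w : ℝ => w * Real.exp w) (1 * Real.exp w + w * Real.exp w) w :=
    (hasDerivAt_id w).mul (Real.hasDerivAt_exp w)
  rw [h.deriv]
  have := Real.exp_pos w
  nlinarith

theorem exists_mul_exp_eq {x : ℝ} (hx : -Real.exp (-1) ≤ x) :
    ∃ w ∈ Set.Ici (-1 : ℝ), w * Real.exp w = x := by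
  have hb : (-1 : ℝ) ≤ max x 0 := by
    have := le_max_right x 0
    linarith
  have h1 : x ≤ max x 0 * Real.exp (max x 0) := by
    have h2 := Real.one_le_exp (le_max_right x 0)
    nlinarith [le_max_right x 0, le_max_left x 0]
  obtain ⟨w, hw, hwx⟩ := intermediate_value_Icc hb
    (f := fun w : ℝ => w * Real.exp w) (by fun_prop) ⟨by simpa using hx, h1⟩
  exact ⟨w, hw.1, hwx⟩

/-- The defining equation `W(x) * exp (W(x)) = x`. -/
theorem lambertW_mul_exp {x : ℝ} (hx : -Real.exp (-1) ≤ x) :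
    lambertW x * Real.exp (lambertW x) = x :=
  Function.invFunOn_eq (exists_mul_exp_eq hx)

theorem neg_one_le_lambertW {x : ℝ} (hx : -Real.exp (-1) ≤ x) : -1 ≤ lambertW x :=
  Function.invFunOn_mem (exists_mul_exp_eq hx)

/-- `W` inverts `w ↦ w * exp w` on `[-1, ∞)`. -/
theorem lambertW_of_mul_exp {w : ℝ} (hw : -1 ≤ w) : lambertW (w * Real.exp w) = w :=
  strictMonoOn_mul_exp.injOn.leftInvOn_invFunOn hw

open Asymptotics

/-! The recursion is x_n = x_{n+1} exp(x_{n+1}), and in the coordinate A = `approxAbel` each step is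
nearly translation by 1, with error O(x_{n+1}^5) (`abs_approxAbel_sub_le`). These errors sum to
O(x_n^4), so A(x_n) = n + K + O(x_n^4) for some K (`exists_approxAbel_limit`).

The stated expansion y_n with C = -K is the formal solution of A(y) = n + K: it satisfies this up to
O((log n)^5/n^4) (`exists_abs_approxAbel_approximant_le`). Since A is at least as steep as 1/(2xy)
(`abs_sub_le_approxAbel`) and x_n, y_n = O(1/n), inverting A gains a factor n^{-2}, which gives the
claimed error. Uniqueness holds because C is the limit of n^2 y_n - n - (log n)/2. -/

/-- An approximate Abel function for the inverse of `x ↦ x * exp x` near `0`: it satisfies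
`approxAbel x - approxAbel (x * exp x) = 1 + O(x ^ 5)`. -/
noncomputable def approxAbel (x : ℝ) : ℝ :=
  1 / x - Real.log x / 2 + x / 6 - x ^ 2 / 16 + 19 / 540 * x ^ 3

/-! ### Estimates for the approximate Abel function -/

theorem exists_exp_eq_sum_add (n : ℕ) (hn : 0 < n) {x : ℝ} (hx : |x| ≤ 1) :
    ∃ ρ : ℝ, |ρ| ≤ 2 ∧
      Real.exp x = ∑ m ∈ Finset.range n, x ^ m / m.factorial + ρ * x ^ n := by
  have h := Real.exp_bound hx hn
  have hc : ((n.succ : ℝ) / (n.factorial * n)) ≤ 2 := by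
    have h1 : (1 : ℝ) ≤ n := by exact_mod_cast hn
    have h2 : (1 : ℝ) ≤ n.factorial := by exact_mod_cast n.factorial_pos
    rw [div_le_iff₀ (by positivity)]
    push_cast
    nlinarith
  rcases eq_or_ne x 0 with rfl | hx0
  · refine ⟨0, by simp, ?_⟩
    have h0 : |(0 : ℝ)| ^ n = 0 := by simp [hn.ne']
    rw [h0, zero_mul] at h
    have := abs_nonpos_iff.1 h
    linarith
  · refine ⟨(Real.exp x - ∑ m ∈ Finset.range n, x ^ m / m.factorial) / x ^ n, ?_, ?_⟩
    · rw [abs_div, abs_pow, div_le_iff₀ (by positivity)]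
      refine h.trans ?_
      rw [mul_comm]
      gcongr
    · field_simp
      ring

/-- The coefficients of `approxAbel` cancel every term up to x^4. Each exponential is expanded just
far enough that its remainder carries x^5; x ≤ 1/3 keeps 3x in the range of the Taylor bound. -/
theorem abs_approxAbel_sub_le {x : ℝ} (hx : 0 < x) (hx3 : x ≤ 1 / 3) :
    |approxAbel x - approxAbel (x * Real.exp x) - 1| ≤ 10 * x ^ 5 := by
  obtain ⟨ρ₀, h₀, e₀⟩ := exists_exp_eq_sum_add 6 (by norm_num) (x := -x)
    (by rw [abs_le]; constructor <;> linarith)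
  obtain ⟨ρ₁, h₁, e₁⟩ := exists_exp_eq_sum_add 4 (by norm_num) (x := x)
    (by rw [abs_le]; constructor <;> linarith)
  obtain ⟨ρ₂, h₂, e₂⟩ := exists_exp_eq_sum_add 3 (by norm_num) (x := 2 * x)
    (by rw [abs_le]; constructor <;> linarith)
  obtain ⟨ρ₃, h₃, e₃⟩ := exists_exp_eq_sum_add 2 (by norm_num) (x := 3 * x)
    (by rw [abs_le]; constructor <;> linarith)
  have hE := Real.exp_pos x
  have hinv : 1 / (x * Real.exp x) = Real.exp (-x) / x := by
    rw [Real.exp_neg]; field_simp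
  have hlog : Real.log (x * Real.exp x) = Real.log x + x := by
    rw [Real.log_mul hx.ne' hE.ne', Real.log_exp]
  have hsq : (x * Real.exp x) ^ 2 = x ^ 2 * Real.exp (2 * x) := by
    rw [mul_pow, ← Real.exp_nat_mul]; norm_num
  have hcb : (x * Real.exp x) ^ 3 = x ^ 3 * Real.exp (3 * x) := by
    rw [mul_pow, ← Real.exp_nat_mul]; norm_num
  have key : approxAbel x - approxAbel (x * Real.exp x) - 1
      = x ^ 5 * (-ρ₀ - ρ₁ / 6 + ρ₂ / 2 - 19 / 60 * ρ₃) := by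
    unfold approxAbel
    rw [hinv, hlog, hsq, hcb, e₀, e₁, e₂, e₃]
    simp only [Finset.sum_range_succ, Finset.sum_range_zero, Nat.factorial]
    push_cast
    field_simp
    ring
  rw [key, abs_mul, abs_of_pos (by positivity : 0 < x ^ 5), mul_comm]
  gcongr
  rw [abs_le] at *
  constructor <;> linarith

/-- The term 1/x contributes (y - x)/(xy), the logarithm has the same sign, and the polynomial part
can cancel at most half of the main term. -/
theorem abs_sub_le_approxAbel {x y : ℝ} (hx : 0 < x) (hy : 0 < y) (hx1 : x ≤ 1) (hy1 : y ≤ 1) :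
    |x - y| ≤ 2 * (x * y) * |approxAbel x - approxAbel y| := by
  wlog hxy : x ≤ y generalizing x y
  · rw [abs_sub_comm, mul_comm x, abs_sub_comm (approxAbel x)]
    exact this hy hx hy1 hx1 (le_of_not_ge hxy)
  have hlog := Real.log_le_log hx hxy
  have hp : 0 < x * y := mul_pos hx hy
  have hp1 : x * y ≤ 1 := mul_le_one₀ hx1 hy.le hy1
  have key : approxAbel x - approxAbel y = (y - x) / (x * y) + (Real.log y - Real.log x) / 2
      - (y - x) * (1 / 6 - (x + y) / 16 + 19 / 540 * (x ^ 2 + x * y + y ^ 2)) := by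
    unfold approxAbel
    field_simp
    ring
  have hb : 1 / 6 - (x + y) / 16 + 19 / 540 * (x ^ 2 + x * y + y ^ 2) ≤ 1 / 2 := by nlinarith
  have h1 : (y - x) * (1 / 6 - (x + y) / 16 + 19 / 540 * (x ^ 2 + x * y + y ^ 2))
      ≤ (y - x) / (x * y) / 2 := by
    have h2 : (1 : ℝ) ≤ 1 / (x * y) := by rw [le_div_iff₀ hp]; linarith
    calc _ ≤ (y - x) * (1 / 2) := mul_le_mul_of_nonneg_left hb (by linarith)
      _ ≤ (y - x) * (1 / (x * y) / 2) := by
        apply mul_le_mul_of_nonneg_left _ (by linarith); linarith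
      _ = _ := by ring
  have h3 : (y - x) / (x * y) / 2 ≤ approxAbel x - approxAbel y := by rw [key]; linarith
  rw [abs_sub_comm, abs_of_nonneg (by linarith : 0 ≤ y - x)]
  calc y - x = 2 * (x * y) * ((y - x) / (x * y) / 2) := by field_simp
    _ ≤ 2 * (x * y) * |approxAbel x - approxAbel y| := by
      gcongr
      exact h3.trans (le_abs_self _)

/-- A crude bound, used to turn A(x_n) ≥ n/2 into x_n ≤ 4/n. -/
theorem approxAbel_le {x : ℝ} (hx : 0 < x) (hx1 : x ≤ 1) : approxAbel x ≤ 2 / x := by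
  have hlog : -Real.log x ≤ 1 / x := by
    rw [← Real.log_inv, one_div]
    exact Real.log_le_self (by positivity)
  have h1 : (1 : ℝ) ≤ 1 / x := by rw [le_div_iff₀ hx]; linarith
  have h2 : x ^ 3 ≤ 1 := pow_le_one₀ hx.le hx1
  have h3 : 2 / x = 2 * (1 / x) := by ring
  unfold approxAbel
  nlinarith [sq_nonneg x]

/-! ### The iterates and the limit of A(x_n) - n -/

section Iteration

variable {x : ℕ → ℝ}

theorem lambertW_pos {y : ℝ} (hy : 0 < y) : 0 < lambertW y := by
  have h := lambertW_mul_exp (x := y) (by linarith [Real.exp_pos (-1)])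
  by_contra hc
  nlinarith [Real.exp_pos (lambertW y)]

theorem iterate_pos (hx0 : 0 < x 0) (hx : ∀ n, x (n + 1) = lambertW (x n)) (n : ℕ) :
    0 < x n := by
  induction n with
  | zero => exact hx0
  | succ n ih => rw [hx]; exact lambertW_pos ih

theorem iterate_mul_exp (hx0 : 0 < x 0) (hx : ∀ n, x (n + 1) = lambertW (x n)) (n : ℕ) :
    x (n + 1) * Real.exp (x (n + 1)) = x n := by
  rw [hx]
  exact lambertW_mul_exp (by linarith [Real.exp_pos (-1), iterate_pos hx0 hx n])

theorem antitone_of_mul_exp (hpos : ∀ n, 0 < x n)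
    (hx : ∀ n, x (n + 1) * Real.exp (x (n + 1)) = x n) : Antitone x := by
  refine antitone_nat_of_succ_le fun n => ?_
  rw [← hx n]
  exact le_mul_of_one_le_right (hpos _).le (Real.one_le_exp (hpos _).le)

theorem tendsto_zero_of_mul_exp (hpos : ∀ n, 0 < x n)
    (hx : ∀ n, x (n + 1) * Real.exp (x (n + 1)) = x n) :
    Filter.Tendsto x Filter.atTop (nhds 0) := by
  have hlim := tendsto_atTop_ciInf (antitone_of_mul_exp hpos hx)
    ⟨0, by rintro _ ⟨n, rfl⟩; exact (hpos n).le⟩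
  set l := ⨅ n, x n
  have h1 : Filter.Tendsto (fun n => x (n + 1)) Filter.atTop (nhds l) :=
    hlim.comp (Filter.tendsto_add_atTop_nat 1)
  have h2 := h1.mul ((Real.continuous_exp.tendsto l).comp h1)
  have h3 : l * Real.exp l = l := by
    refine tendsto_nhds_unique h2 (hlim.congr fun n => ?_)
    simp [hx n]
  have hl : l = 0 := by
    by_contra h
    have : Real.exp l = 1 := by
      apply mul_left_cancel₀ h
      rw [h3, mul_one]
    exact h (Real.exp_eq_one_iff l |>.1 this)
  rwa [hl] at hlim

/-- Follows from exp(4x) ≥ 1 + 4x. It makes the fifth-power errors telescope, so no decay rate of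
x_n is needed beforehand. -/
theorem four_mul_pow_five_le (hpos : ∀ n, 0 < x n)
    (hx : ∀ n, x (n + 1) * Real.exp (x (n + 1)) = x n) (n : ℕ) :
    4 * x (n + 1) ^ 5 ≤ x n ^ 4 - x (n + 1) ^ 4 := by
  have h := hpos (n + 1)
  have h1 : 4 * x (n + 1) + 1 ≤ Real.exp (4 * x (n + 1)) := Real.add_one_le_exp _
  have h2 : x n ^ 4 = x (n + 1) ^ 4 * Real.exp (4 * x (n + 1)) := by
    rw [← hx n, mul_pow, ← Real.exp_nat_mul]; norm_num
  rw [h2]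
  nlinarith [pow_pos h 4]

theorem exists_approxAbel_limit (hpos : ∀ n, 0 < x n)
    (hx : ∀ n, x (n + 1) * Real.exp (x (n + 1)) = x n) :
    ∃ K : ℝ, ∀ᶠ n in Filter.atTop, |approxAbel (x n) - n - K| ≤ 10 * x n ^ 4 := by
  have hlim := tendsto_zero_of_mul_exp hpos hx
  obtain ⟨N, hN⟩ := Filter.eventually_atTop.1
    (hlim.eventually (Iio_mem_nhds (show (0 : ℝ) < 1 / 3 by norm_num)))
  set D : ℕ → ℝ := fun n => approxAbel (x n) - n with hD
  have hstep : ∀ n ≥ N, |D (n + 1) - D n| ≤ 10 * (x n ^ 4 - x (n + 1) ^ 4) := by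
    intro n hn
    have h1 := abs_approxAbel_sub_le (hpos (n + 1)) (le_of_lt (hN (n + 1) (by omega)))
    rw [hx n] at h1
    have h2 : D (n + 1) - D n = approxAbel (x (n + 1)) - approxAbel (x n) - 1 := by
      simp only [hD]; push_cast; ring
    rw [h2]
    linarith [four_mul_pow_five_le hpos hx n, pow_pos (hpos (n + 1)) 5]
  have htail : ∀ n ≥ N, ∀ k, |D (n + k) - D n| ≤ 10 * (x n ^ 4 - x (n + k) ^ 4) := by
    intro n hn k
    induction k with
    | zero => simp
    | succ k ih =>
      have h1 := hstep (n + k) (by omega)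
      have h2 := abs_sub_le (D (n + (k + 1))) (D (n + k)) (D n)
      rw [add_assoc] at h1
      linarith
  have hx4 : Filter.Tendsto (fun n => 10 * x n ^ 4) Filter.atTop (nhds 0) := by
    simpa using (hlim.pow 4).const_mul 10
  have hbound : ∀ n ≥ N, ∀ k, |D (n + k) - D n| ≤ 10 * x n ^ 4 := fun n hn k =>
    (htail n hn k).trans (by linarith [pow_pos (hpos (n + k)) 4])
  have hcauchy : CauchySeq fun k => D (k + N) := by
    refine cauchySeq_of_le_tendsto_0' (fun k => 10 * x (k + N) ^ 4) ?_
      ((Filter.tendsto_add_atTop_iff_nat N).2 hx4)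
    intro n m hnm
    obtain ⟨k, rfl⟩ := Nat.exists_eq_add_of_le hnm
    rw [dist_comm, Real.dist_eq, add_right_comm]
    exact hbound (n + N) (by omega) k
  obtain ⟨K, hK'⟩ := cauchySeq_tendsto_of_complete hcauchy
  have hK : Filter.Tendsto D Filter.atTop (nhds K) := (Filter.tendsto_add_atTop_iff_nat N).1 hK'
  refine ⟨K, ?_⟩
  filter_upwards [Filter.eventually_ge_atTop N] with n hn
  have h1 : Filter.Tendsto (fun k => |D (n + k) - D n|) Filter.atTop (nhds |K - D n|) := by
    have : Filter.Tendsto (fun k => D (n + k)) Filter.atTop (nhds K) := by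
      simpa only [add_comm n] using (Filter.tendsto_add_atTop_iff_nat n).2 hK
    exact (this.sub_const _).abs
  rw [abs_sub_comm]
  exact le_of_tendsto' h1 (hbound n hn)

end Iteration
-- Formal solution of the Abel equation
/-! Coefficients of the expansion `t * (1 + ∑ aₖ lᵏ)`, where `t = 1 / n`, `l = log n / n`
and `r = 1 / log n`. -/

noncomputable def coeff₁ (C r : ℝ) : ℝ := 1 / 2 + C * r

noncomputable def coeff₂ (C r : ℝ) : ℝ :=
  1 / 4 + (C - 1 / 4) * r + (C ^ 2 - 1 / 2 * C + 1 / 6) * r ^ 2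

noncomputable def coeff₃ (C r : ℝ) : ℝ :=
  1 / 8 + (3 / 4 * C - 5 / 16) * r + (3 / 2 * C ^ 2 - 5 / 4 * C + 3 / 8) * r ^ 2
    + (C ^ 3 - 5 / 4 * C ^ 2 + 3 / 4 * C - 7 / 48) * r ^ 3

noncomputable def coeff₄ (C r : ℝ) : ℝ :=
  1 / 16 + (1 / 2 * C - 13 / 48) * r + (3 / 2 * C ^ 2 - 13 / 8 * C + 17 / 32) * r ^ 2
    + (2 * C ^ 3 - 13 / 4 * C ^ 2 + 17 / 8 * C - 23 / 48) * r ^ 3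
    + (C ^ 4 - 13 / 6 * C ^ 3 + 17 / 8 * C ^ 2 - 23 / 24 * C + 707 / 4320) * r ^ 4

/-- The relative correction: the approximant is `t * (1 + relCorr C l r)`. -/
noncomputable def relCorr (C l r : ℝ) : ℝ :=
  coeff₁ C r * l + coeff₂ C r * l ^ 2 + coeff₃ C r * l ^ 3 + coeff₄ C r * l ^ 4

/-- All remainders below are polynomials in l and r for fixed C, so compactness of the unit square
bounds them without explicit constants. -/
theorem exists_abs_le_of_continuous {f : ℝ → ℝ → ℝ} (hf : Continuous fun p : ℝ × ℝ => f p.1 p.2) :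
    ∃ M : ℝ, 0 < M ∧ ∀ l ∈ Set.Icc (0 : ℝ) 1, ∀ r ∈ Set.Icc (0 : ℝ) 1, |f l r| ≤ M := by
  obtain ⟨M, hM⟩ := (isCompact_Icc.prod isCompact_Icc :
    IsCompact (Set.Icc (0 : ℝ) 1 ×ˢ Set.Icc (0 : ℝ) 1)).exists_bound_of_continuousOn hf.continuousOn
  exact ⟨max M 1, by positivity, fun l hl r hr => (hM (l, r) ⟨hl, hr⟩).trans (le_max_left _ _)⟩

theorem exists_abs_relCorr_le (C : ℝ) :
    ∃ B : ℝ, 0 < B ∧ ∀ l ∈ Set.Icc (0 : ℝ) 1, ∀ r ∈ Set.Icc (0 : ℝ) 1,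
      |relCorr C l r| ≤ B * l := by
  obtain ⟨B, hB, h⟩ := exists_abs_le_of_continuous
    (f := fun l r => coeff₁ C r + coeff₂ C r * l + coeff₃ C r * l ^ 2 + coeff₄ C r * l ^ 3)
    (by unfold coeff₁ coeff₂ coeff₃ coeff₄; fun_prop)
  refine ⟨B, hB, fun l hl r hr => ?_⟩
  have e : relCorr C l r =
      (coeff₁ C r + coeff₂ C r * l + coeff₃ C r * l ^ 2 + coeff₄ C r * l ^ 3) * l := by
    unfold relCorr; ring
  rw [e, abs_mul, abs_of_nonneg hl.1]
  exact mul_le_mul_of_nonneg_right (h l hl r hr) hl.1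

/-- The truncation of `1 / (1 + ∑ aₖ lᵏ)` at order four. -/
noncomputable def invTrunc (a b c d l : ℝ) : ℝ :=
  1 - a * l + (a ^ 2 - b) * l ^ 2 + (2 * a * b - a ^ 3 - c) * l ^ 3
    + (2 * a * c + b ^ 2 - 3 * a ^ 2 * b + a ^ 4 - d) * l ^ 4

noncomputable def invRemainder (a b c d l : ℝ) : ℝ :=
  (a * (2 * a * c + b ^ 2 - 3 * a ^ 2 * b + a ^ 4 - d) + b * (2 * a * b - a ^ 3 - c)
      + c * (a ^ 2 - b) - d * a)
    + l * (b * (2 * a * c + b ^ 2 - 3 * a ^ 2 * b + a ^ 4 - d) + c * (2 * a * b - a ^ 3 - c)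
      + d * (a ^ 2 - b))
    + l ^ 2 * (c * (2 * a * c + b ^ 2 - 3 * a ^ 2 * b + a ^ 4 - d) + d * (2 * a * b - a ^ 3 - c))
    + l ^ 3 * (d * (2 * a * c + b ^ 2 - 3 * a ^ 2 * b + a ^ 4 - d))

theorem mul_invTrunc (a b c d l : ℝ) :
    (1 + (a * l + b * l ^ 2 + c * l ^ 3 + d * l ^ 4)) * invTrunc a b c d l
      = 1 + l ^ 5 * invRemainder a b c d l := by
  unfold invTrunc invRemainder; ring

/-- Order three suffices here: in the Abel equation the logarithm is multiplied by t = l r, which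
supplies one more power of l. -/
noncomputable def logTrunc (a b c l : ℝ) : ℝ :=
  a * l + (b - a ^ 2 / 2) * l ^ 2 + (c - a * b + a ^ 3 / 3) * l ^ 3

noncomputable def logRemainder (a b c d l : ℝ) : ℝ :=
  d - (2 * a * (c + d * l) + (b + (c + d * l) * l) ^ 2) / 2
    + (b + (c + d * l) * l) * ((a + (b + (c + d * l) * l) * l) ^ 2
        + (a + (b + (c + d * l) * l) * l) * a + a ^ 2) / 3

theorem taylor_log_eq (a b c d l : ℝ) :
    (a * l + b * l ^ 2 + c * l ^ 3 + d * l ^ 4) - (a * l + b * l ^ 2 + c * l ^ 3 + d * l ^ 4) ^ 2 / 2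
      + (a * l + b * l ^ 2 + c * l ^ 3 + d * l ^ 4) ^ 3 / 3
      = logTrunc a b c l + l ^ 4 * logRemainder a b c d l := by
  unfold logTrunc logRemainder; ring

/-- The polynomial terms of `approxAbel` at t(1 + s), multiplied by t = l r and cut off after l^4.
-/
noncomputable def tailTrunc (a b l r : ℝ) : ℝ :=
  1 / 6 * r ^ 2 * l ^ 2 * (1 + a * l + b * l ^ 2) - 1 / 16 * r ^ 3 * l ^ 3 * (1 + 2 * a * l)
    + 19 / 540 * r ^ 4 * l ^ 4

noncomputable def tailRemainder (a b c d l r : ℝ) : ℝ :=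
  1 / 6 * r ^ 2 * (c + d * l)
    - 1 / 16 * r ^ 3 * (2 * (b + (c + d * l) * l) + (a + (b + (c + d * l) * l) * l) ^ 2)
    + 19 / 540 * r ^ 4 * ((a + (b + (c + d * l) * l) * l)
      * (3 + 3 * (a * l + b * l ^ 2 + c * l ^ 3 + d * l ^ 4)
        + (a * l + b * l ^ 2 + c * l ^ 3 + d * l ^ 4) ^ 2))

theorem tail_eq (a b c d l r : ℝ) :
    1 / 6 * (l * r) ^ 2 * (1 + (a * l + b * l ^ 2 + c * l ^ 3 + d * l ^ 4))
      - 1 / 16 * (l * r) ^ 3 * (1 + (a * l + b * l ^ 2 + c * l ^ 3 + d * l ^ 4)) ^ 2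
      + 19 / 540 * (l * r) ^ 4 * (1 + (a * l + b * l ^ 2 + c * l ^ 3 + d * l ^ 4)) ^ 3
      = tailTrunc a b l r + l ^ 5 * tailRemainder a b c d l r := by
  unfold tailTrunc tailRemainder; ring

/-- The coefficients solve the truncated Abel equation order by order. -/
theorem trunc_eq_one (C l r : ℝ) :
    invTrunc (coeff₁ C r) (coeff₂ C r) (coeff₃ C r) (coeff₄ C r) l + l / 2 + C * (l * r)
      - l * r / 2 * logTrunc (coeff₁ C r) (coeff₂ C r) (coeff₃ C r) l
      + tailTrunc (coeff₁ C r) (coeff₂ C r) l r = 1 := by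
  unfold invTrunc logTrunc tailTrunc coeff₁ coeff₂ coeff₃ coeff₄; ring

/-! ### The Abel function at the approximant -/

theorem abs_log_one_add_sub_le {s : ℝ} (hs : |s| ≤ 1 / 2) :
    |Real.log (1 + s) - (s - s ^ 2 / 2 + s ^ 3 / 3)| ≤ 2 * |s| ^ 4 := by
  have h := Real.abs_log_sub_add_sum_range_le (x := -s) (by rw [abs_neg]; linarith) 3
  simp only [Finset.sum_range_succ, Finset.sum_range_zero, abs_neg, sub_neg_eq_add] at h
  have e : Real.log (1 + s) - (s - s ^ 2 / 2 + s ^ 3 / 3)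
      = 0 + (-s) ^ (0 + 1) / ((0 : ℕ) + 1) + (-s) ^ (1 + 1) / ((1 : ℕ) + 1)
        + (-s) ^ (2 + 1) / ((2 : ℕ) + 1) + Real.log (1 + s) := by
    push_cast; ring
  rw [e]
  refine h.trans ?_
  rw [div_le_iff₀ (by linarith)]
  calc |s| ^ 4 = 2 * |s| ^ 4 * (1 - 1 / 2) := by ring
    _ ≤ 2 * |s| ^ 4 * (1 - |s|) := by gcongr

/-- Multiplying by t makes every term a power series in l with coefficients polynomial in r. By
`trunc_eq_one` the orders up to l^4 cancel, leaving only remainders of size l^5. -/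
theorem exists_abs_approxAbel_approximant_le (C : ℝ) :
    ∃ M δ : ℝ, 0 < M ∧ 0 < δ ∧ ∀ t l r : ℝ, 0 < r → r ≤ 1 → 0 < l → l ≤ δ → t = l * r →
      -Real.log t = l / t → |relCorr C l r| ≤ 1 / 2 ∧
      |t * (approxAbel (t * (1 + relCorr C l r)) - 1 / t + C)| ≤ M * l ^ 5 := by
  obtain ⟨B, hB, hs⟩ := exists_abs_relCorr_le C
  obtain ⟨M₁, hM₁, h₁⟩ := exists_abs_le_of_continuous
    (f := fun l r => invRemainder (coeff₁ C r) (coeff₂ C r) (coeff₃ C r) (coeff₄ C r) l)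
    (by unfold invRemainder coeff₁ coeff₂ coeff₃ coeff₄; fun_prop)
  obtain ⟨M₂, hM₂, h₂⟩ := exists_abs_le_of_continuous
    (f := fun l r => logRemainder (coeff₁ C r) (coeff₂ C r) (coeff₃ C r) (coeff₄ C r) l)
    (by unfold logRemainder coeff₁ coeff₂ coeff₃ coeff₄; fun_prop)
  obtain ⟨M₃, hM₃, h₃⟩ := exists_abs_le_of_continuous
    (f := fun l r => tailRemainder (coeff₁ C r) (coeff₂ C r) (coeff₃ C r) (coeff₄ C r) l r)
    (by unfold tailRemainder coeff₁ coeff₂ coeff₃ coeff₄; fun_prop)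
  -- The summands bound the reciprocal (with 1/(1 + s) ≤ 2), the logarithm's Taylor error, the
  -- logarithm's truncation and the polynomial tail. The bound l ≤ 1/(2B) forces |s| ≤ 1/2.
  refine ⟨2 * M₁ + B ^ 4 + M₂ + M₃, min 1 (1 / (2 * B)), by positivity, by positivity, ?_⟩
  intro t l r hr hr1 hl hlδ ht hlog
  have hl1 : l ≤ 1 := hlδ.trans (min_le_left _ _)
  have hlI : l ∈ Set.Icc (0 : ℝ) 1 := ⟨hl.le, hl1⟩
  have hrI : r ∈ Set.Icc (0 : ℝ) 1 := ⟨hr.le, hr1⟩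
  specialize hs l hlI r hrI
  specialize h₁ l hlI r hrI
  specialize h₂ l hlI r hrI
  specialize h₃ l hlI r hrI
  have hs2 : |relCorr C l r| ≤ 1 / 2 := by
    refine hs.trans ?_
    calc B * l ≤ B * (1 / (2 * B)) := by gcongr; exact hlδ.trans (min_le_right _ _)
      _ = 1 / 2 := by field_simp
  refine ⟨hs2, ?_⟩
  have hlt := abs_log_one_add_sub_le hs2
  have hinv := mul_invTrunc (coeff₁ C r) (coeff₂ C r) (coeff₃ C r) (coeff₄ C r) l
  have htay := taylor_log_eq (coeff₁ C r) (coeff₂ C r) (coeff₃ C r) (coeff₄ C r) l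
  have htail := tail_eq (coeff₁ C r) (coeff₂ C r) (coeff₃ C r) (coeff₄ C r) l r
  have hone := trunc_eq_one C l r
  have hsdef : coeff₁ C r * l + coeff₂ C r * l ^ 2 + coeff₃ C r * l ^ 3 + coeff₄ C r * l ^ 4
    = relCorr C l r := rfl
  rw [hsdef] at hinv htay htail
  generalize invTrunc (coeff₁ C r) (coeff₂ C r) (coeff₃ C r) (coeff₄ C r) l = E at *
  generalize invRemainder (coeff₁ C r) (coeff₂ C r) (coeff₃ C r) (coeff₄ C r) l = R₁ at *
  generalize logTrunc (coeff₁ C r) (coeff₂ C r) (coeff₃ C r) l = T at *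
  generalize logRemainder (coeff₁ C r) (coeff₂ C r) (coeff₃ C r) (coeff₄ C r) l = R₂ at *
  generalize tailTrunc (coeff₁ C r) (coeff₂ C r) l r = S at *
  generalize tailRemainder (coeff₁ C r) (coeff₂ C r) (coeff₃ C r) (coeff₄ C r) l r = R₃ at *
  generalize relCorr C l r = s at *
  have hs1 : 1 / 2 ≤ 1 + s := by linarith [(abs_le.1 hs2).1]
  have ht0 : 0 < t := by rw [ht]; positivity
  have hs0 : 0 < 1 + s := by linarith
  set ρ := Real.log (1 + s) - (s - s ^ 2 / 2 + s ^ 3 / 3) with hρ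
  have hlogy : Real.log (t * (1 + s)) = -(l / t) + (ρ + T + l ^ 4 * R₂) := by
    rw [Real.log_mul ht0.ne' hs0.ne', ← hlog]; linarith
  have hinv' : 1 / (1 + s) = E - l ^ 5 * (R₁ / (1 + s)) := by
    field_simp; linarith
  have key : t * (approxAbel (t * (1 + s)) - 1 / t + C)
      = -(l ^ 5 * (R₁ / (1 + s))) - l * r / 2 * ρ - l ^ 5 * (r / 2 * R₂) + l ^ 5 * R₃ := by
    have e1 : t * (approxAbel (t * (1 + s)) - 1 / t + C)
        = 1 / (1 + s) - t * Real.log (t * (1 + s)) / 2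
          + (1 / 6 * t ^ 2 * (1 + s) - 1 / 16 * t ^ 3 * (1 + s) ^ 2
            + 19 / 540 * t ^ 4 * (1 + s) ^ 3) - 1 + C * t := by
      unfold approxAbel
      field_simp
      ring
    have e2 : t * (-(l / t) + (ρ + T + l ^ 4 * R₂)) = -l + t * (ρ + T + l ^ 4 * R₂) := by
      field_simp
    rw [e1, hlogy, hinv', e2, ht, htail]
    linear_combination hone
  have b₁ : |l ^ 5 * (R₁ / (1 + s))| ≤ 2 * M₁ * l ^ 5 := by
    rw [abs_mul, abs_div, abs_of_pos hs0, abs_of_pos (by positivity : 0 < l ^ 5), mul_comm]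
    gcongr
    rw [div_le_iff₀ hs0]
    calc |R₁| ≤ 2 * M₁ * (1 / 2) := by linarith only [h₁]
      _ ≤ 2 * M₁ * (1 + s) := by gcongr
  have b₂ : |l * r / 2 * ρ| ≤ B ^ 4 * l ^ 5 := by
    have h4 : |s| ^ 4 ≤ (B * l) ^ 4 := by gcongr
    rw [abs_mul, abs_of_pos (by positivity : 0 < l * r / 2)]
    calc l * r / 2 * |ρ| ≤ l * 1 / 2 * (2 * (B * l) ^ 4) := by
          gcongr
          exact hlt.trans (by gcongr)
      _ = B ^ 4 * l ^ 5 := by ring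
  have b₃ : |l ^ 5 * (r / 2 * R₂)| ≤ M₂ * l ^ 5 := by
    rw [abs_mul, abs_mul, abs_of_pos (by positivity : 0 < l ^ 5),
      abs_of_pos (by positivity : 0 < r / 2), mul_comm]
    gcongr
    calc r / 2 * |R₂| ≤ 1 * M₂ := by
          gcongr
          linarith only [hr1]
      _ = M₂ := one_mul _
  have b₄ : |l ^ 5 * R₃| ≤ M₃ * l ^ 5 := by
    rw [abs_mul, abs_of_pos (by positivity : 0 < l ^ 5), mul_comm]
    gcongr
  rw [key]
  clear_value ρ
  rw [abs_le] at b₁ b₂ b₃ b₄ ⊢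
  constructor <;> linarith only [b₁, b₂, b₃, b₄]
-- Comparison of the iterates with the expansion
/-- The truncated asymptotic expansion with constant `C`. -/
noncomputable def approximant (C : ℝ) (n : ℕ) : ℝ :=
  1 / (n : ℝ)
          + 1 / 2 * (Real.log n / (n : ℝ) ^ 2)
          + C * (1 / (n : ℝ) ^ 2)
          + 1 / 4 * (Real.log n ^ 2 / (n : ℝ) ^ 3)
          + (C - 1 / 4) * (Real.log n / (n : ℝ) ^ 3)
          + (C ^ 2 - 1 / 2 * C + 1 / 6) * (1 / (n : ℝ) ^ 3)
          + 1 / 8 * (Real.log n ^ 3 / (n : ℝ) ^ 4)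
          + (3 / 4 * C - 5 / 16) * (Real.log n ^ 2 / (n : ℝ) ^ 4)
          + (3 / 2 * C ^ 2 - 5 / 4 * C + 3 / 8) * (Real.log n / (n : ℝ) ^ 4)
          + (C ^ 3 - 5 / 4 * C ^ 2 + 3 / 4 * C - 7 / 48) * (1 / (n : ℝ) ^ 4)
          + 1 / 16 * (Real.log n ^ 4 / (n : ℝ) ^ 5)
          + (1 / 2 * C - 13 / 48) * (Real.log n ^ 3 / (n : ℝ) ^ 5)
          + (3 / 2 * C ^ 2 - 13 / 8 * C + 17 / 32) * (Real.log n ^ 2 / (n : ℝ) ^ 5)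
          + (2 * C ^ 3 - 13 / 4 * C ^ 2 + 17 / 8 * C - 23 / 48) * (Real.log n / (n : ℝ) ^ 5)
          + (C ^ 4 - 13 / 6 * C ^ 3 + 17 / 8 * C ^ 2 - 23 / 24 * C + 707 / 4320)
              * (1 / (n : ℝ) ^ 5)

theorem approximant_eq (C : ℝ) {n : ℕ} (hn : 0 < (n : ℝ)) (hL : 0 < Real.log n) :
    approximant C n = 1 / n * (1 + relCorr C (Real.log n / n) (1 / Real.log n)) := by
  unfold approximant relCorr coeff₁ coeff₂ coeff₃ coeff₄
  field_simp
  ring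

theorem tendsto_log_natCast_atTop :
    Filter.Tendsto (fun n : ℕ => Real.log n) Filter.atTop Filter.atTop :=
  Real.tendsto_log_atTop.comp tendsto_natCast_atTop_atTop

theorem tendsto_log_pow_div_natCast (k : ℕ) :
    Filter.Tendsto (fun n : ℕ => Real.log n ^ k / n) Filter.atTop (nhds 0) := by
  have h := Real.isLittleO_pow_log_id_atTop (n := k)
  exact h.tendsto_div_nhds_zero.comp tendsto_natCast_atTop_atTop

theorem isBigO_sub_approximant {x : ℕ → ℝ} (hpos : ∀ n, 0 < x n)
    (hx : ∀ n, x (n + 1) * Real.exp (x (n + 1)) = x n) :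
    ∃ C : ℝ, (fun n : ℕ => x n - approximant C n)
      =O[Filter.atTop] fun n : ℕ => Real.log n ^ 5 / (n : ℝ) ^ 6 := by
  obtain ⟨K, hK⟩ := exists_approxAbel_limit hpos hx
  obtain ⟨M, δ, hM, hδ, hy⟩ := exists_abs_approxAbel_approximant_le (-K)
  -- Here 16 = 2 · 4 · 2 comes from the steepness bound with x_n ≤ 4/n and y ≤ 2/n, and 2560 = 10 ·
  -- 4^4 from the error 10 x_n^4.
  refine ⟨-K, IsBigO.of_bound (16 * (2560 + M)) ?_⟩
  have hx0 := tendsto_zero_of_mul_exp hpos hx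
  filter_upwards [hK, hx0.eventually (Iio_mem_nhds (show (0 : ℝ) < 1 by norm_num)),
    tendsto_log_natCast_atTop.eventually_ge_atTop 1,
    (tendsto_log_pow_div_natCast 1).eventually (Iio_mem_nhds hδ),
    tendsto_natCast_atTop_atTop.eventually_ge_atTop (2 * |K| + 20)]
    with n hK hx1 hL hlδ hn
  have hn0 : (0 : ℝ) < n := by linarith [abs_nonneg K]
  have hL0 : 0 < Real.log n := by linarith
  obtain ⟨hs, hyn⟩ := hy (1 / n) (Real.log n / n) (1 / Real.log n) (by positivity)
    (by rw [div_le_one hL0]; exact hL) (by positivity)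
    (by simpa using hlδ.le) (by field_simp) (by rw [one_div, Real.log_inv]; field_simp)
  rw [← approximant_eq _ hn0 hL0] at hyn
  set y := approximant (-K) n with hydef
  have hyeq := approximant_eq (-K) hn0 hL0
  rw [← hydef] at hyeq
  rw [abs_le] at hs
  have hy0 : 0 < y := by
    rw [hyeq]; exact mul_pos (by positivity) (by linarith)
  have hy2 : y ≤ 2 / n := by
    rw [hyeq]
    calc _ ≤ 1 / (n : ℝ) * 2 := by gcongr; linarith
      _ = 2 / n := by ring
  have hy1 : y ≤ 1 := hy2.trans (by rw [div_le_one hn0]; linarith [abs_nonneg K])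
  have hxn := hpos n
  have hx4 : x n ≤ 4 / n := by
    have h1 := approxAbel_le hxn (le_of_lt hx1)
    have h2 := (abs_le.1 hK).1
    have h3 : x n ^ 4 ≤ 1 := pow_le_one₀ hxn.le (le_of_lt hx1)
    -- A(x_n) ≥ n - |K| - 10 ≥ n/2, which is why n ≥ 2|K| + 20 was required.
    have h4 : (n : ℝ) / 2 ≤ 2 / x n := by linarith [neg_abs_le K]
    rw [le_div_iff₀ hxn] at h4
    rw [le_div_iff₀ hn0]
    linarith
  have hyn' : |approxAbel y - n - K| ≤ M * (Real.log n ^ 5 / (n : ℝ) ^ 4) := by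
    rw [abs_mul, abs_of_pos (by positivity : (0 : ℝ) < 1 / n)] at hyn
    have e : approxAbel y - 1 / (1 / (n : ℝ)) + -K = approxAbel y - n - K := by
      rw [one_div_one_div]; ring
    rw [e] at hyn
    calc |approxAbel y - n - K| = n * (1 / n * |approxAbel y - n - K|) := by field_simp
      _ ≤ n * (M * (Real.log n / n) ^ 5) := by gcongr
      _ = _ := by field_simp
  have hxn' : |approxAbel (x n) - n - K| ≤ 2560 * (Real.log n ^ 5 / (n : ℝ) ^ 4) := by
    calc _ ≤ 10 * x n ^ 4 := hK
      _ ≤ 10 * (4 / n) ^ 4 := by gcongr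
      _ = 2560 * (1 / (n : ℝ) ^ 4) := by ring
      _ ≤ _ := by gcongr; exact one_le_pow₀ hL
  have hd : |approxAbel (x n) - approxAbel y|
      ≤ (2560 + M) * (Real.log n ^ 5 / (n : ℝ) ^ 4) := by
    have := abs_sub_le (approxAbel (x n) - n - K) 0 (approxAbel y - n - K)
    rw [sub_zero, zero_sub, abs_neg] at this
    calc _ = |approxAbel (x n) - n - K - (approxAbel y - n - K)| := by congr 1; ring
      _ ≤ _ := by linarith
  rw [Real.norm_eq_abs, Real.norm_eq_abs,
    abs_of_nonneg (by positivity : 0 ≤ Real.log n ^ 5 / (n : ℝ) ^ 6)]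
  calc |x n - y| ≤ 2 * (x n * y) * |approxAbel (x n) - approxAbel y| :=
        abs_sub_le_approxAbel hxn hy0 (le_of_lt hx1) hy1
    _ ≤ 2 * (4 / n * (2 / n)) * ((2560 + M) * (Real.log n ^ 5 / (n : ℝ) ^ 4)) := by gcongr
    _ = _ := by field_simp; ring

/-! ### Uniqueness of the constant -/

theorem tendsto_sq_mul_approximant (C : ℝ) :
    Filter.Tendsto (fun n : ℕ => (n : ℝ) ^ 2 * approximant C n - n - Real.log n / 2)
      Filter.atTop (nhds C) := by
  have hl : Filter.Tendsto (fun n : ℕ => Real.log n / n) Filter.atTop (nhds 0) := by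
    simpa using tendsto_log_pow_div_natCast 1
  have hr : Filter.Tendsto (fun n : ℕ => 1 / Real.log n) Filter.atTop (nhds 0) :=
    tendsto_log_natCast_atTop.const_div_atTop 1
  have hcont : Continuous fun p : ℝ × ℝ =>
      coeff₂ C p.2 + coeff₃ C p.2 * p.1 + coeff₄ C p.2 * p.1 ^ 2 := by
    unfold coeff₂ coeff₃ coeff₄; fun_prop
  -- After scaling by n^2, the terms beyond C equal (log n)^2/n times a polynomial in l and r, which
  -- converges as (l, r) → (0, 0).
  have h := ((tendsto_log_pow_div_natCast 2).mul
    ((hcont.tendsto (0, 0)).comp (hl.prodMk_nhds hr))).const_add C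
  rw [zero_mul, add_zero] at h
  refine h.congr' ?_
  filter_upwards [tendsto_log_natCast_atTop.eventually_gt_atTop 0,
    (tendsto_natCast_atTop_atTop (R := ℝ)).eventually_gt_atTop 0] with n hL hn
  rw [approximant_eq C hn hL]
  simp only [Function.comp, relCorr, coeff₁]
  field_simp
  ring

/-- Subtracting the two expansions removes x_n; scaled by n^2, the difference tends to C' - C, while
the error (log n)^5/n^4 tends to 0. -/
theorem approximant_const_unique {x : ℕ → ℝ} {C C' : ℝ}
    (h : (fun n : ℕ => x n - approximant C n)
      =O[Filter.atTop] fun n : ℕ => Real.log n ^ 5 / (n : ℝ) ^ 6)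
    (h' : (fun n : ℕ => x n - approximant C' n)
      =O[Filter.atTop] fun n : ℕ => Real.log n ^ 5 / (n : ℝ) ^ 6) : C = C' := by
  have h1 : (fun n : ℕ => (n : ℝ) ^ 2 * (approximant C' n - approximant C n))
      =O[Filter.atTop] fun n : ℕ => (n : ℝ) ^ 2 * (Real.log n ^ 5 / (n : ℝ) ^ 6) :=
    (isBigO_refl _ _).mul ((h.sub h').congr_left fun n => by ring)
  have h2 : Filter.Tendsto (fun n : ℕ => (n : ℝ) ^ 2 * (Real.log n ^ 5 / (n : ℝ) ^ 6))
      Filter.atTop (nhds 0) := by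
    have h3 := (tendsto_log_pow_div_natCast 5).mul
      ((tendsto_inv_atTop_nhds_zero_nat (𝕜 := ℝ)).pow 3)
    rw [zero_mul] at h3
    refine h3.congr' ?_
    filter_upwards [Filter.eventually_gt_atTop 0] with n hn
    have : (0 : ℝ) < n := by exact_mod_cast hn
    field_simp
  have h3 := (tendsto_sq_mul_approximant C').sub (tendsto_sq_mul_approximant C)
  have h4 := tendsto_nhds_unique (h1.trans_tendsto h2) (h3.congr fun n => by ring)
  linarith

theorem mainTheorem11 (x : ℕ → ℝ) (hx0 : 0 < x 0)
    (hx : ∀ n : ℕ, 1 ≤ n → x n = lambertW (x (n - 1))) :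
    ∃! C : ℝ,
      (fun n : ℕ => x n -
        (1 / (n : ℝ)
          + 1 / 2 * (Real.log n / (n : ℝ) ^ 2)
          + C * (1 / (n : ℝ) ^ 2)
          + 1 / 4 * (Real.log n ^ 2 / (n : ℝ) ^ 3)
          + (C - 1 / 4) * (Real.log n / (n : ℝ) ^ 3)
          + (C ^ 2 - 1 / 2 * C + 1 / 6) * (1 / (n : ℝ) ^ 3)
          + 1 / 8 * (Real.log n ^ 3 / (n : ℝ) ^ 4)
          + (3 / 4 * C - 5 / 16) * (Real.log n ^ 2 / (n : ℝ) ^ 4)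
          + (3 / 2 * C ^ 2 - 5 / 4 * C + 3 / 8) * (Real.log n / (n : ℝ) ^ 4)
          + (C ^ 3 - 5 / 4 * C ^ 2 + 3 / 4 * C - 7 / 48) * (1 / (n : ℝ) ^ 4)
          + 1 / 16 * (Real.log n ^ 4 / (n : ℝ) ^ 5)
          + (1 / 2 * C - 13 / 48) * (Real.log n ^ 3 / (n : ℝ) ^ 5)
          + (3 / 2 * C ^ 2 - 13 / 8 * C + 17 / 32) * (Real.log n ^ 2 / (n : ℝ) ^ 5)
          + (2 * C ^ 3 - 13 / 4 * C ^ 2 + 17 / 8 * C - 23 / 48) * (Real.log n / (n : ℝ) ^ 5)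
          + (C ^ 4 - 13 / 6 * C ^ 3 + 17 / 8 * C ^ 2 - 23 / 24 * C + 707 / 4320)
              * (1 / (n : ℝ) ^ 5)))
        =O[Filter.atTop] fun n : ℕ => Real.log n ^ 5 / (n : ℝ) ^ 6 := by

  have hx' : ∀ n, x (n + 1) = lambertW (x n) := fun n => hx (n + 1) (by omega)
  obtain ⟨C, hC⟩ := isBigO_sub_approximant (iterate_pos hx0 hx') (iterate_mul_exp hx0 hx')
  exact ⟨C, hC, fun C' hC' => approximant_const_unique hC' hC⟩
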